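/- Let $d$ be a natural number and let $\lambda$ denote Lebesgue measure on $\mathbb{R}^d$ with its Euclidean norm $|\cdot|$. Call a set $P\subseteq\mathbb{R}^d$ a \emph{polyhedron} if its topological boundary $\partial P$ can be covered by finitely many (affine) hyperplanes. A bounded set $A\subseteq\mathbb{R}^d$ is \emph{distance Kolmogorov} if for every $\varepsilon>0$ there is a 1-Lipschitz map $f:A\to\mathbb{R}^d$ such that $f(A)$ is a polyhedron and $|f(x)-x|\le\varepsilon$ for every $x\in A$. A bounded Lebesgue measurable set $A\subseteq\mathbb{R}^d$ is \emph{measure Kolmogorov} if for every $\varepsilon>0$ there is a 1-Lipschitz map $f:A\to\mathbb{R}^d$ such that $f(A)$ is a polyhedron and $\lambda(f(A))>\lambda(A)-\varepsilon$. Theorem. Every Lebesgue measurable set $A\subseteq\mathbb{R}^d$ that is distance Kolmogorov is also measure Kolmogorov. -/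

import Mathlib

open MeasureTheory

/-- A hyperplane of `ℝ^d`: the solution set of `⟪a, x⟫ = b` for some `a ≠ 0`. -/
def IsHyperplane {d : ℕ} (H : Set (EuclideanSpace ℝ (Fin d))) : Prop :=
  ∃ (a : EuclideanSpace ℝ (Fin d)) (b : ℝ), a ≠ 0 ∧ H = {x | inner ℝ a x = b}

/-- A polyhedron in `ℝ^d`: a set whose topological boundary can be covered by finitely many
hyperplanes. -/
def IsPolyhedron {d : ℕ} (A : Set (EuclideanSpace ℝ (Fin d))) : Prop :=
  ∃ 𝓗 : Set (Set (EuclideanSpace ℝ (Fin d))),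
    𝓗.Finite ∧ (∀ H ∈ 𝓗, IsHyperplane H) ∧ frontier A ⊆ ⋃₀ 𝓗

/-- A bounded Lebesgue measurable set `A ⊆ ℝ^d` is measure Kolmogorov if it can be mapped onto a
polyhedron by a 1-Lipschitz map `f : A → ℝ^d` with arbitrarily small measure loss. Both `A` and
its image are bounded, so both real-valued measures below are genuine. -/
def IsMeasureKolmogorov {d : ℕ} (A : Set (EuclideanSpace ℝ (Fin d))) : Prop :=
  Bornology.IsBounded A ∧ NullMeasurableSet A volume ∧
    ∀ ε : ℝ, 0 < ε → ∃ f : A → EuclideanSpace ℝ (Fin d),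
      LipschitzWith 1 f ∧ IsPolyhedron (Set.range f) ∧
        volume.real (Set.range f) > volume.real A - ε

/-- A bounded set `A ⊆ ℝ^d` is distance Kolmogorov if it can be mapped onto a polyhedron by a
1-Lipschitz map `f : A → ℝ^d` with arbitrarily small displacement. -/
def IsDistanceKolmogorov {d : ℕ} (A : Set (EuclideanSpace ℝ (Fin d))) : Prop :=
  Bornology.IsBounded A ∧
    ∀ ε : ℝ, 0 < ε → ∃ f : A → EuclideanSpace ℝ (Fin d),
      LipschitzWith 1 f ∧ IsPolyhedron (Set.range f) ∧
        ∀ x : A, ‖f x - (x : EuclideanSpace ℝ (Fin d))‖ ≤ ε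

/-! A 1-Lipschitz map `f` of small displacement cannot lose much volume, so the map given by the
distance property at a small scale already works. By Lebesgue density and the Besicovitch covering
theorem, finitely many disjoint balls carry almost all of `A`, with `A` nearly filling each. On one
such ball `B`, extend `f` to a Lipschitz `F` on the whole space. Points of a slightly smaller ball
are close to `A`, so `F` moves them little and therefore covers a still smaller concentric ball.
What is covered comes from `A` or from `B \ A`, and the image of the latter is small because `F` is
Lipschitz.

Covering is Brouwer-type and is proved by volume. For a Lipschitz `g` vanishing off a ball, the
integral of `det (1 + t Dg)` over the ball is a polynomial in `t`. For small `t` the map `x + t g x`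
permutes the ball, so the polynomial is constantly the volume. A map onto a sphere would make it
vanish at `t = 1`. -/

/-! ### Volume and Jacobians of Lipschitz maps -/

open Set Metric Module Filter Topology in
theorem LipschitzWith.addHaar_image_le {E : Type*} [NormedAddCommGroup E] [InnerProductSpace ℝ E]
    [FiniteDimensional ℝ E] [MeasurableSpace E] [BorelSpace E] (μ : Measure E) [μ.IsAddHaarMeasure]
    {K : NNReal} {f : E → E} (hf : LipschitzWith K f) (s : Set E) :
    μ (f '' s) ≤ (K : ENNReal) ^ finrank ℝ E * μ s := by
  have hc := Measure.isAddLeftInvariant_eq_smul μ (Measure.hausdorffMeasure (X := E) (finrank ℝ E))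
  have h2 := hf.hausdorffMeasure_image_le (d := finrank ℝ E) (by positivity) s
  rw [hc, Measure.smul_apply, Measure.smul_apply, ENNReal.smul_def, ENNReal.smul_def, smul_eq_mul,
    smul_eq_mul, mul_left_comm]
  gcongr
  simpa using h2

/-- The determinant of `1 + M` as an affine combination of the determinants of `1 + t • M`, where
`t` runs through finitely many arbitrarily placed nodes. -/
theorem ContinuousLinearMap.det_one_add_eq_sum_lagrange {E : Type*} [NormedAddCommGroup E]
    [NormedSpace ℝ E] [FiniteDimensional ℝ E] (M : E →L[ℝ] E) (s : Finset ℝ)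
    (hs : Module.finrank ℝ E < s.card) :
    (1 + M).det = ∑ t ∈ s, (1 + t • M).det * (Lagrange.basis s id t).eval 1 := by
  classical
  let b := Module.finBasis ℝ E
  let A := LinearMap.toMatrix b b (M : E →ₗ[ℝ] E)
  let p : Polynomial ℝ :=
    Matrix.det ((Polynomial.X : Polynomial ℝ) • A.map Polynomial.C
      + (1 : Matrix _ _ ℝ).map Polynomial.C)
  have hp : ∀ t : ℝ, p.eval t = (1 + t • M).det := by
    intro t
    rw [ContinuousLinearMap.det, ← LinearMap.det_toMatrix b]
    simp only [p]
    rw [← Polynomial.coe_evalRingHom, RingHom.map_det]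
    congr 1
    ext i j
    have : LinearMap.toMatrix b b ((1 + t • M : E →L[ℝ] E) : E →ₗ[ℝ] E) = 1 + t • A := by
      rw [show ((1 + t • M : E →L[ℝ] E) : E →ₗ[ℝ] E) = 1 + t • (M : E →ₗ[ℝ] E) from rfl, map_add,
        map_smul, LinearMap.toMatrix_one]
    rw [this]
    simp only [Matrix.add_apply, Matrix.smul_apply, Matrix.one_apply, smul_eq_mul]
    split_ifs with hij <;> simp [hij] <;> ring
  -- The determinant has degree at most the dimension in `t`, so interpolation at more nodes than
  -- that is exact.
  have hd : p.degree < s.card := by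
    refine lt_of_le_of_lt Polynomial.degree_le_natDegree ?_
    have := Polynomial.natDegree_det_X_add_C_le A 1
    rw [Fintype.card_fin] at this
    exact_mod_cast this.trans_lt hs
  have h1 := congrArg (Polynomial.eval 1)
    (Lagrange.eq_interpolate (s := s) (v := id) (Set.injOn_id _) hd)
  rw [hp, one_smul] at h1
  rw [h1, Lagrange.interpolate_apply, Polynomial.eval_finsetSum]
  simp [hp]

/-- Change of variables for a small Lipschitz perturbation of the identity supported in a ball. -/
theorem LipschitzWith.integral_det_one_add_smul {E : Type*} [NormedAddCommGroup E]
    [InnerProductSpace ℝ E] [FiniteDimensional ℝ E] [MeasurableSpace E] [BorelSpace E]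
    (μ : Measure E) [μ.IsAddHaarMeasure] {K : NNReal} {g : E → E} (hg : LipschitzWith K g) {R : ℝ}
    (hR : ∀ x ∉ Metric.ball (0 : E) R, g x = 0) {t : ℝ} (ht : 0 ≤ t) (htK : t * K < 1)
    (hdet : ∀ M : E →L[ℝ] E, ‖M‖ ≤ K → 0 < (1 + t • M).det) :
    IntegrableOn (fun x => (1 + t • fderiv ℝ g x).det) (Metric.ball 0 R) μ ∧
      ∫ x in Metric.ball 0 R, (1 + t • fderiv ℝ g x).det ∂μ = μ.real (Metric.ball 0 R) := by
  set B := Metric.ball (0 : E) R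
  set S := {x | DifferentiableAt ℝ g x} ∩ B
  set F : E → E := fun x => x + t • g x with hF
  have hmS : MeasurableSet S := (measurableSet_of_differentiableAt ℝ g).inter measurableSet_ball
  have hnull : μ (B \ S) = 0 := by
    have := hg.ae_differentiableAt (μ := μ)
    refine measure_mono_null ?_ (ae_iff.1 this)
    intro x hx hd
    exact hx.2 ⟨hd, hx.1⟩
  have hSB : S =ᵐ[μ] B := by
    have h1 : S ⊆ B := Set.inter_subset_right
    exact (ae_le_set.2 (by simp [Set.sdiff_eq_empty.2 h1])).antisymm (ae_le_set.2 hnull)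
  have happ : ApproximatesLinearOn F (ContinuousLinearEquiv.refl ℝ E : E →L[ℝ] E) Set.univ
      (t.toNNReal * K) := by
    intro x _ y _
    have : F x - F y - (ContinuousLinearEquiv.refl ℝ E : E →L[ℝ] E) (x - y) = t • (g x - g y) := by
      simp [hF, smul_sub]
      abel
    rw [this, norm_smul, Real.norm_of_nonneg ht]
    push_cast
    rw [Real.coe_toNNReal _ ht, mul_assoc]
    gcongr
    exact hg.norm_sub_le x y
  -- In dimension zero the identity has norm `0`, whose inverse is `0` by convention; hence the
  -- separate case.
  have hc : Subsingleton E ∨ t.toNNReal * K <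
      ‖((ContinuousLinearEquiv.refl ℝ E).symm : E →L[ℝ] E)‖₊⁻¹ := by
    rcases subsingleton_or_nontrivial E with h | h
    · exact Or.inl h
    · right
      have : ‖((ContinuousLinearEquiv.refl ℝ E).symm : E →L[ℝ] E)‖₊ = 1 := by
        apply NNReal.eq
        exact ContinuousLinearMap.norm_id
      rw [this, inv_one, ← NNReal.coe_lt_coe]
      push_cast
      rwa [Real.coe_toNNReal _ ht]
  have hinj : Function.Injective F := Set.injOn_univ.1 (happ.injOn hc)
  have hsurj : Function.Surjective F := happ.surjective hc
  have hFB : F '' B = B := by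
    have h1 : F '' Bᶜ = Bᶜ := by
      rw [Set.image_congr (g := id) (fun x hx => by simp [hF, hR x hx]), Set.image_id]
    rw [← compl_inj_iff, ← Set.image_compl_eq ⟨hinj, hsurj⟩, h1]
  have hFlip : LipschitzWith (1 + t.toNNReal * K) F := by
    refine LipschitzWith.id.add (LipschitzWith.of_dist_le_mul fun x y => ?_)
    rw [dist_eq_norm, ← smul_sub, norm_smul, Real.norm_of_nonneg ht]
    push_cast
    rw [Real.coe_toNNReal _ ht, mul_assoc, ← dist_eq_norm]
    gcongr
    exact hg.dist_le_mul x y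
  have hFS : μ (F '' S) = μ B := by
    apply le_antisymm
    · rw [← hFB]
      exact measure_mono (by rw [hFB]; conv_rhs => rw [← hFB]
                             exact Set.image_mono Set.inter_subset_right)
    · conv_lhs => rw [← hFB]
      have h0 : μ (F '' (B \ S)) = 0 := by
        have := hFlip.addHaar_image_le μ (B \ S)
        rw [hnull, mul_zero] at this
        exact le_antisymm this zero_le
      calc μ (F '' B) ≤ μ (F '' S ∪ F '' (B \ S)) := by
            apply measure_mono
            rw [← Set.image_union]
            apply Set.image_mono
            intro x hx
            by_cases h : x ∈ S
            · exact Or.inl h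
            · exact Or.inr ⟨hx, h⟩
        _ ≤ μ (F '' S) + μ (F '' (B \ S)) := measure_union_le _ _
        _ = μ (F '' S) := by rw [h0, add_zero]
  have hder : ∀ x ∈ S, HasFDerivWithinAt F (1 + t • fderiv ℝ g x) S x := fun x hx =>
    ((hasFDerivAt_id x).add (hx.1.hasFDerivAt.const_smul t)).hasFDerivWithinAt
  have hlint := lintegral_abs_det_fderiv_eq_addHaar_image μ hmS hder hinj.injOn
  rw [hFS, setLIntegral_congr hSB] at hlint
  have hpos : ∀ x, 0 < (1 + t • fderiv ℝ g x).det := fun x =>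
    hdet _ (norm_fderiv_le_of_lipschitz ℝ hg)
  simp_rw [abs_of_pos (hpos _)] at hlint
  have hmeas : Measurable fun x => (1 + t • fderiv ℝ g x).det :=
    ContinuousLinearMap.continuous_det.measurable.comp
      (((measurable_fderiv ℝ g).const_smul t).const_add 1)
  constructor
  · refine ⟨hmeas.aestronglyMeasurable, ?_⟩
    rw [hasFiniteIntegral_iff_ofReal (Filter.Eventually.of_forall fun x => (hpos x).le), hlint]
    exact measure_ball_lt_top
  · rw [integral_eq_lintegral_of_nonneg_ae (Filter.Eventually.of_forall fun x => (hpos x).le)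
      hmeas.aestronglyMeasurable, hlint, Measure.real]

/-- The integral of the Jacobian of a Lipschitz map that is the identity off a ball. -/
theorem LipschitzWith.integral_det_one_add {E : Type*} [NormedAddCommGroup E]
    [InnerProductSpace ℝ E] [FiniteDimensional ℝ E] [MeasurableSpace E] [BorelSpace E]
    (μ : Measure E) [μ.IsAddHaarMeasure] {K : NNReal} {g : E → E} (hg : LipschitzWith K g) {R : ℝ}
    (hR : ∀ x ∉ Metric.ball (0 : E) R, g x = 0) :
    ∫ x in Metric.ball 0 R, (1 + fderiv ℝ g x).det ∂μ = μ.real (Metric.ball 0 R) := by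
  obtain ⟨δ, hδ, hdet⟩ : ∃ δ > 0, ∀ M : E →L[ℝ] E, ‖M‖ < δ → 0 < (1 + M).det := by
    have hc : Continuous fun M : E →L[ℝ] E => (1 + M).det :=
      ContinuousLinearMap.continuous_det.comp (continuous_const.add continuous_id)
    have h0 : 0 < (1 + (0 : E →L[ℝ] E)).det := by
      rw [add_zero, ContinuousLinearMap.det, ContinuousLinearMap.toLinearMap_one, map_one]
      exact one_pos
    have := (hc.tendsto 0).eventually (lt_mem_nhds h0)
    obtain ⟨δ, hδ, h⟩ := Metric.eventually_nhds_iff.1 this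
    exact ⟨δ, hδ, fun M hM => h (by simpa using hM)⟩
  -- The first bound makes `x + t g x` bijective, the second keeps its Jacobian positive.
  obtain ⟨a, ha, ha1, ha2⟩ : ∃ a > 0, a * (K : ℝ) < 1 ∧ a * (K : ℝ) < δ := by
    have hK := K.coe_nonneg
    refine ⟨min 1 δ / (K + 1), by positivity, ?_, ?_⟩
    all_goals
      rw [div_mul_eq_mul_div, div_lt_iff₀ (by positivity)]
    · nlinarith [min_le_left 1 δ, lt_min one_pos hδ]
    · nlinarith [min_le_right 1 δ, lt_min one_pos hδ]
  obtain ⟨s, hsub, hcard⟩ := (Set.Ioo_infinite ha).exists_subset_card_eq (Module.finrank ℝ E + 1)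
  have key : ∀ t ∈ s, _ := fun t ht =>
    have h0 : 0 < t ∧ t < a := hsub ht
    have hK := K.coe_nonneg
    have h1 : t * K ≤ a * K := by gcongr; exact h0.2.le
    hg.integral_det_one_add_smul μ hR h0.1.le (h1.trans_lt ha1) (fun M hM => hdet _ (by
      rw [norm_smul, Real.norm_of_nonneg h0.1.le]
      calc t * ‖M‖ ≤ t * K := by gcongr; exact h0.1.le
        _ < δ := h1.trans_lt ha2))
  have hne : s.Nonempty := Finset.card_pos.1 (by omega)
  simp_rw [fun x => (fderiv ℝ g x).det_one_add_eq_sum_lagrange s (by omega)]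
  rw [integral_finsetSum _ fun t ht => (key t ht).1.mul_const _]
  simp_rw [integral_mul_const]
  -- All nodes give the same integral, and the Lagrange weights sum to one.
  rw [Finset.sum_congr rfl fun t ht => by rw [(key t ht).2], ← Finset.mul_sum,
    ← Polynomial.eval_finsetSum, Lagrange.sum_basis (Set.injOn_id _) hne]
  simp

/-! ### Surjectivity and covering of balls -/

/-- A map of constant norm near a point has degenerate derivative there. -/
theorem HasFDerivAt.det_eq_zero_of_norm_eventually_const {E : Type*} [NormedAddCommGroup E]
    [InnerProductSpace ℝ E] [FiniteDimensional ℝ E] {G : E → E} {L : E →L[ℝ] E} {x : E} {R : ℝ}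
    (hG : HasFDerivAt G L x) (hR : 0 < R) (h : ∀ᶠ y in nhds x, ‖G y‖ = R) : L.det = 0 := by
  by_contra hdet
  have h1 : HasFDerivAt (fun y => ‖G y‖ ^ 2) (2 • (innerSL ℝ (G x)).comp L) x := hG.norm_sq
  have h2 : HasFDerivAt (fun y => ‖G y‖ ^ 2) (0 : E →L[ℝ] ℝ) x :=
    (hasFDerivAt_const (R ^ 2) x).congr_of_eventuallyEq (h.mono fun y hy => by simp [hy])
  have h3 := h1.unique h2
  have hu : IsUnit (L : E →ₗ[ℝ] E) :=
    (LinearMap.isUnit_iff_isUnit_det _).2 (isUnit_iff_ne_zero.2 hdet)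
  obtain ⟨v, hv⟩ := ((Module.End.isUnit_iff _).1 hu).2 (G x)
  have hv' : L v = G x := hv
  -- Differentiating the squared norm along `v`, where `L v = G x`, gives `2 ‖G x‖ ^ 2 = 0`.
  have h4 := congrArg (fun M : E →L[ℝ] ℝ => M v) h3
  simp [hv'] at h4
  rw [← norm_eq_zero, h.self_of_nhds] at h4
  exact hR.ne' h4

/-- If a value `p` were missed, pushing values radially away from `p` onto a large sphere would stay
Lipschitz, and its Jacobian would vanish almost everywhere in the ball, against the volume identity.
-/
theorem LipschitzWith.surjective_of_eq_self_off_ball {E : Type*} [NormedAddCommGroup E]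
    [InnerProductSpace ℝ E] [FiniteDimensional ℝ E] {K : NNReal} {F : E → E}
    (hF : LipschitzWith K F) {R : ℝ} (hR : ∀ x ∉ Metric.ball (0 : E) R, F x = x) :
    Function.Surjective F := by
  by_contra hns
  simp only [Function.Surjective, not_forall, not_exists] at hns
  obtain ⟨p, hp⟩ := hns
  set F₁ : E → E := fun x => F (x + p) - p with hF₁
  have hF₁lip : LipschitzWith K F₁ := LipschitzWith.of_dist_le_mul fun x y => by
    simpa [hF₁] using hF.dist_le_mul (x + p) (y + p)
  have hF₁0 : ∀ x, F₁ x ≠ 0 := fun x hx => hp _ (sub_eq_zero.1 hx)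
  set R₁ : ℝ := max (R + ‖p‖) 1
  have hR₁ : 0 < R₁ := lt_of_lt_of_le one_pos (le_max_right _ _)
  have hid : ∀ x, R₁ ≤ ‖x‖ → F₁ x = x := by
    intro x hx
    have hxp : x + p ∉ Metric.ball (0 : E) R := by
      have h1 : R + ‖p‖ ≤ R₁ := le_max_left _ _
      have h2 : ‖x‖ ≤ ‖x + p‖ + ‖p‖ := by simpa using _root_.norm_sub_le (x + p) p
      simp only [Metric.mem_ball, dist_zero_right, not_lt]
      linarith
    simp [hF₁, hR _ hxp]
  obtain ⟨ρ, hρ, hρF⟩ : ∃ ρ > 0, ∀ x, ρ ≤ ‖F₁ x‖ := by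
    obtain ⟨z, -, hz⟩ := (isCompact_closedBall (0 : E) R₁).exists_isMinOn
      ⟨0, Metric.mem_closedBall_self hR₁.le⟩ hF₁lip.continuous.norm.continuousOn
    refine ⟨min ‖F₁ z‖ R₁, lt_min (norm_pos_iff.2 (hF₁0 z)) hR₁, fun x => ?_⟩
    by_cases hx : ‖x‖ ≤ R₁
    · exact (min_le_left _ _).trans (hz (by simpa using hx))
    · rw [hid x (not_le.1 hx).le]
      exact (min_le_right _ _).trans (not_le.1 hx).le
  set R₂ : ℝ := R₁ + (‖F₁ 0‖ + K * R₁)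
  have hKR : 0 ≤ K * R₁ := by positivity
  have hR₁₂ : R₁ ≤ R₂ := by
    have := norm_nonneg (F₁ 0)
    simp only [R₂]
    linarith
  have hR₂ : 0 < R₂ := hR₁.trans_le hR₁₂
  have hF₁R : ∀ x, ‖x‖ < R₂ → ‖F₁ x‖ ≤ R₂ := by
    intro x hx
    by_cases h : R₁ ≤ ‖x‖
    · rw [hid x h]
      exact hx.le
    · have h1 : ‖F₁ x‖ ≤ ‖F₁ 0‖ + ‖F₁ x - F₁ 0‖ := norm_le_norm_add_norm_sub' _ _
      have h2 : ‖F₁ x - F₁ 0‖ ≤ K * ‖x‖ := by simpa using hF₁lip.norm_sub_le x 0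
      have h3 : K * ‖x‖ ≤ K * R₁ := by gcongr; exact (not_le.1 h).le
      simp only [R₂]
      linarith
  -- Values inside the sphere of radius `R₂` are pushed out to it, the others stay; the bound `ρ`
  -- keeps this Lipschitz.
  set m : E → ℝ := fun x => max (R₂ / ‖F₁ x‖) 1 with hm
  set G : E → E := fun x => m x • F₁ x with hG
  have hpos : ∀ x, 0 < ‖F₁ x‖ := fun x => hρ.trans_le (hρF x)
  have hGball : ∀ x, ‖x‖ < R₂ → ‖G x‖ = R₂ := by
    intro x hx
    have : m x = R₂ / ‖F₁ x‖ := max_eq_left ((one_le_div (hpos x)).2 (hF₁R x hx))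
    rw [hG]
    simp only
    rw [this, norm_smul, Real.norm_of_nonneg (div_pos hR₂ (hpos x)).le,
      div_mul_cancel₀ _ (hpos x).ne']
  have hGid : ∀ x, R₂ ≤ ‖x‖ → G x = x := by
    intro x hx
    have h1 := hid x (hR₁₂.trans hx)
    have : m x = 1 := by
      rw [hm]
      simp only
      rw [h1]
      exact max_eq_right (div_le_one_of_le₀ hx (norm_nonneg _))
    rw [hG]
    simp only
    rw [this, h1, one_smul]
  have hGlip : LipschitzWith ((R₂ / ρ + 1 + R₂ / ρ).toNNReal * K) G := by
    refine LipschitzWith.of_dist_le_mul fun x y => ?_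
    have e1 : G x - G y = m x • (F₁ x - F₁ y) + (m x - m y) • F₁ y := by
      simp only [hG, smul_sub, sub_smul]
      abel
    have e2 : ‖F₁ x - F₁ y‖ ≤ K * dist x y := by
      rw [dist_eq_norm]
      exact hF₁lip.norm_sub_le x y
    have e3 : |m x| ≤ R₂ / ρ + 1 := by
      have h1 : R₂ / ‖F₁ x‖ ≤ R₂ / ρ := by gcongr; exact hρF x
      have h2 : 0 < R₂ / ρ := by positivity
      rw [abs_of_pos (lt_of_lt_of_le one_pos (le_max_right _ _))]
      exact max_le (by linarith) (by linarith)
    have e4 : |m x - m y| * ‖F₁ y‖ ≤ R₂ / ρ * ‖F₁ x - F₁ y‖ := by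
      have h1 : |m x - m y| ≤ |R₂ / ‖F₁ x‖ - R₂ / ‖F₁ y‖| := abs_max_sub_max_le_abs _ _ _
      have h2 : |R₂ / ‖F₁ x‖ - R₂ / ‖F₁ y‖| * ‖F₁ y‖ =
          R₂ / ‖F₁ x‖ * |‖F₁ y‖ - ‖F₁ x‖| := by
        have hx := hpos x
        have hy := hpos y
        rw [show R₂ / ‖F₁ x‖ - R₂ / ‖F₁ y‖ = R₂ / (‖F₁ x‖ * ‖F₁ y‖) * (‖F₁ y‖ - ‖F₁ x‖) by
          field_simp, abs_mul, abs_of_pos (by positivity)]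
        field_simp
      calc |m x - m y| * ‖F₁ y‖ ≤ |R₂ / ‖F₁ x‖ - R₂ / ‖F₁ y‖| * ‖F₁ y‖ := by gcongr
        _ = R₂ / ‖F₁ x‖ * |‖F₁ y‖ - ‖F₁ x‖| := h2
        _ ≤ R₂ / ρ * ‖F₁ x - F₁ y‖ := by
          gcongr
          · exact hρF x
          · rw [abs_sub_comm]
            exact abs_norm_sub_norm_le _ _
    have h0 : 0 < R₂ / ρ := by positivity
    push_cast
    rw [Real.coe_toNNReal _ (by positivity), dist_eq_norm, e1]
    calc ‖m x • (F₁ x - F₁ y) + (m x - m y) • F₁ y‖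
        ≤ |m x| * ‖F₁ x - F₁ y‖ + |m x - m y| * ‖F₁ y‖ := by
          refine (norm_add_le _ _).trans ?_
          rw [norm_smul, norm_smul, Real.norm_eq_abs, Real.norm_eq_abs]
      _ ≤ (R₂ / ρ + 1) * ‖F₁ x - F₁ y‖ + R₂ / ρ * ‖F₁ x - F₁ y‖ := by gcongr
      _ = (R₂ / ρ + 1 + R₂ / ρ) * ‖F₁ x - F₁ y‖ := by ring
      _ ≤ (R₂ / ρ + 1 + R₂ / ρ) * (K * dist x y) := by gcongr
      _ = _ := by ring
  let _ : MeasurableSpace E := borel E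
  have : BorelSpace E := ⟨rfl⟩
  let μ : Measure E := Measure.addHaar
  have hg := hGlip.sub LipschitzWith.id
  have hint := hg.integral_det_one_add μ (R := R₂) fun x hx => by
    simp only [Metric.mem_ball, dist_zero_right, not_lt] at hx
    simp [hGid x hx]
  have hzero : ∫ x in Metric.ball 0 R₂, (1 + fderiv ℝ (fun x => G x - id x) x).det ∂μ = 0 := by
    rw [setIntegral_congr_ae (g := fun _ => (0 : ℝ)) measurableSet_ball]
    · simp
    · filter_upwards [hGlip.ae_differentiableAt (μ := μ)] with x hx hxB
      have h1 : fderiv ℝ (fun x => G x - id x) x = fderiv ℝ G x - 1 :=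
        (hx.hasFDerivAt.sub (hasFDerivAt_id x)).fderiv
      rw [h1, add_sub_cancel]
      refine hx.hasFDerivAt.det_eq_zero_of_norm_eventually_const hR₂ ?_
      filter_upwards [Metric.isOpen_ball.mem_nhds hxB] with y hy
      exact hGball y (by simpa using hy)
  have hBpos : 0 < μ.real (Metric.ball 0 R₂) :=
    ENNReal.toReal_pos (Metric.measure_ball_pos μ 0 hR₂).ne' measure_ball_lt_top.ne
  exact hBpos.ne' (hint.symm.trans hzero)

/-- A Lipschitz map that moves the points of a ball by at most `e` covers the concentric ball whose
radius is smaller by `2 * e`. -/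
theorem LipschitzWith.ball_subset_image_closedBall {E : Type*} [NormedAddCommGroup E]
    [InnerProductSpace ℝ E] [FiniteDimensional ℝ E] {K : NNReal} {F : E → E}
    (hF : LipschitzWith K F) {c : E} {s e : ℝ} (he : 0 < e)
    (h : ∀ x ∈ Metric.closedBall c s, ‖F x - x‖ ≤ e) :
    Metric.ball c (s - 2 * e) ⊆ F '' Metric.closedBall c s := by
  -- The cutoff blends `F`, within distance `s - e` of `c`, with the identity outside the ball. A
  -- preimage of a point of the small ball lies at most `e` away, hence where `χ = 1`.
  set χ : E → ℝ := fun x => max 0 (min 1 ((s - dist x c) / e)) with hχ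
  have hχ0 : ∀ x, 0 ≤ χ x := fun x => le_max_left _ _
  have hχ1 : ∀ x, χ x ≤ 1 := fun x => max_le zero_le_one (min_le_left _ _)
  have hχout : ∀ x ∉ Metric.closedBall c s, χ x = 0 := by
    intro x hx
    rw [Metric.mem_closedBall, not_le] at hx
    exact max_eq_left ((min_le_right _ _).trans (div_nonpos_of_nonpos_of_nonneg (by linarith) he.le))
  have hχlip : ∀ x y, |χ x - χ y| ≤ dist x y / e := by
    intro x y
    have h1 : |χ x - χ y| ≤ |(s - dist x c) / e - (s - dist y c) / e| := by
      simp only [hχ]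
      rw [max_comm 0, max_comm 0, min_comm 1, min_comm 1]
      refine (abs_max_sub_max_le_abs _ _ _).trans ((abs_min_sub_min_le_max _ _ _ _).trans ?_)
      simp
    refine h1.trans ?_
    rw [← sub_div, abs_div, abs_of_pos he]
    gcongr
    rw [sub_sub_sub_cancel_left, abs_sub_comm]
    exact abs_dist_sub_le _ _ _
  set k : E → E := fun x => F x - x with hk
  have hklip : LipschitzWith (K + 1) k := hF.sub LipschitzWith.id
  have haux : ∀ x y, y ∈ Metric.closedBall c s →
      ‖χ x • k x - χ y • k y‖ ≤ (K + 1 + 1) * dist x y := by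
    intro x y hy
    have e1 : χ x • k x - χ y • k y = χ x • (k x - k y) + (χ x - χ y) • k y := by
      simp only [smul_sub, sub_smul]
      abel
    have e2 : ‖k x - k y‖ ≤ (K + 1) * dist x y := by
      rw [dist_eq_norm]
      exact_mod_cast hklip.norm_sub_le x y
    rw [e1]
    calc _ ≤ |χ x| * ‖k x - k y‖ + |χ x - χ y| * ‖k y‖ := by
          refine (norm_add_le _ _).trans ?_
          rw [norm_smul, norm_smul, Real.norm_eq_abs, Real.norm_eq_abs]
      _ ≤ 1 * ((K + 1) * dist x y) + dist x y / e * e := by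
          gcongr
          · rw [abs_of_nonneg (hχ0 x)]
            exact hχ1 x
          · exact hχlip x y
          · exact h y hy
      _ = _ := by
          field_simp
  have hlip : LipschitzWith (K + 1 + 1) fun x => χ x • k x := by
    refine LipschitzWith.of_dist_le_mul fun x y => ?_
    rw [dist_eq_norm]
    push_cast
    by_cases hy : y ∈ Metric.closedBall c s
    · exact haux x y hy
    by_cases hx : x ∈ Metric.closedBall c s
    · rw [norm_sub_rev, dist_comm]
      exact haux y x hx
    · rw [hχout x hx, hχout y hy]
      simp only [zero_smul, sub_zero, norm_zero]
      positivity
  have hsurj : Function.Surjective fun x => x + χ x • k x := by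
    refine (LipschitzWith.id.add hlip).surjective_of_eq_self_off_ball (R := ‖c‖ + s + 1) ?_
    intro x hx
    have : x ∉ Metric.closedBall c s := by
      intro hxc
      apply hx
      rw [mem_closedBall_iff_norm] at hxc
      rw [mem_ball_zero_iff]
      have := norm_le_norm_add_norm_sub' x c
      linarith
    simp [hχout x this]
  intro p hp
  obtain ⟨x, hx⟩ := hsurj p
  have hx : x + χ x • k x = p := hx
  have hmove : ‖χ x • k x‖ ≤ e := by
    by_cases hxs : x ∈ Metric.closedBall c s
    · rw [norm_smul, Real.norm_of_nonneg (hχ0 x)]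
      calc χ x * ‖k x‖ ≤ 1 * e := by
            gcongr
            · exact hχ1 x
            · exact h x hxs
        _ = e := one_mul e
    · rw [hχout x hxs, zero_smul, norm_zero]
      exact he.le
  have hxc : dist x c < s - e := by
    have h1 : dist x p ≤ e := by
      rw [← hx, dist_eq_norm, sub_add_cancel_left, norm_neg]
      exact hmove
    have h2 := dist_triangle x p c
    rw [Metric.mem_ball] at hp
    linarith
  have hχx : χ x = 1 := by
    have : 1 ≤ (s - dist x c) / e := by
      rw [one_le_div he]
      linarith
    simp only [hχ]
    rw [min_eq_left this, max_eq_right zero_le_one]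
  refine ⟨x, ?_, ?_⟩
  · rw [Metric.mem_closedBall]
    linarith
  · rw [← hx, hχx, one_smul]
    simp [hk]

/-! ### Lower bounds for the measure of the image -/

/-- The image of a set that fills most of a ball, under a `1`-Lipschitz map that moves the points of
the set by little compared with the radius, still fills most of the ball. -/
theorem exists_measureReal_range_inter_closedBall_ge {E : Type*} [NormedAddCommGroup E]
    [InnerProductSpace ℝ E] [FiniteDimensional ℝ E] [MeasurableSpace E] [BorelSpace E]
    (μ : Measure E) [μ.IsAddHaarMeasure] {κ : ℝ} (hκ : 0 < κ) :
    ∃ θ > 0, ∃ η > 0, ∀ (A : Set E) (c : E) (r : ℝ), 0 < r →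
      μ.real (Metric.closedBall c r \ A) ≤ θ * μ.real (Metric.closedBall c r) →
      ∀ f : A → E, LipschitzWith 1 f → (∀ x : A, ‖f x - x‖ ≤ η * r) →
        (1 - κ) * μ.real (Metric.closedBall c r) ≤
          μ.real (Set.range f ∩ Metric.closedBall c r) := by
  set C : NNReal := lipschitzExtensionConstant E
  set n := Module.finrank ℝ E
  -- Shrinking to the points near `A` costs `η`, covering costs `2 * (C + 2) * η`, and one more `η`
  -- passes from open to closed balls.
  set D : ℝ := 2 * C + 6
  obtain ⟨η, hη, hη1, hηn⟩ : ∃ η > 0, η < 1 / D ∧ 1 - κ / 2 < (1 - D * η) ^ n := by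
    have hD : 0 < D := by positivity
    have h1 : ∀ᶠ η in nhds (0 : ℝ), 1 - κ / 2 < (1 - D * η) ^ n := by
      have hc : Continuous fun η : ℝ => (1 - D * η) ^ n := by fun_prop
      refine (hc.tendsto 0).eventually (lt_mem_nhds ?_)
      simpa using hκ
    have h2 : ∀ᶠ η in nhdsWithin (0 : ℝ) (Set.Ioi 0), η ∈ Set.Ioo 0 (1 / D) :=
      Ioo_mem_nhdsGT (by positivity)
    obtain ⟨η, ha, hb⟩ := ((h1.filter_mono nhdsWithin_le_nhds).and h2).exists
    exact ⟨η, hb.1, hb.2, ha⟩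
  -- The first bound forces every ball of radius `η * r` inside `B` to meet `A`; the second controls
  -- the image of `B \ A`.
  obtain ⟨θ, hθ, hθη, hθκ⟩ : ∃ θ > 0, θ < η ^ n ∧ (C : ℝ) ^ n * θ ≤ κ / 2 := by
    refine ⟨min (η ^ n / 2) (κ / 2 / (C ^ n + 1)), by positivity, ?_, ?_⟩
    · have : 0 < η ^ n := by positivity
      exact (min_le_left _ _).trans_lt (by linarith)
    · calc (C : ℝ) ^ n * min (η ^ n / 2) (κ / 2 / (C ^ n + 1))
          ≤ (C : ℝ) ^ n * (κ / 2 / (C ^ n + 1)) := by gcongr; exact min_le_right _ _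
        _ = (κ / 2) * (C ^ n / (C ^ n + 1)) := by ring
        _ ≤ (κ / 2) * 1 := by
          gcongr
          exact div_le_one_of_le₀ (by linarith) (by positivity)
        _ = κ / 2 := mul_one _
  refine ⟨θ, hθ, η, hη, fun A c r hr hA f hf hfη => ?_⟩
  have hC : (0 : ℝ) ≤ C := C.coe_nonneg
  have hDη : D * η < 1 := by
    rw [lt_div_iff₀ (by positivity)] at hη1
    linarith
  have hηr : 0 < η * r := by positivity
  have hball : ∀ (x : E) {t : ℝ}, 0 ≤ t →
      μ.real (Metric.closedBall x t) = t ^ n * μ.real (Metric.ball 0 1) := fun x t ht =>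
    μ.addHaar_real_closedBall x ht
  have hV : 0 < μ.real (Metric.ball (0 : E) 1) :=
    ENNReal.toReal_pos (Metric.measure_ball_pos μ 0 one_pos).ne' measure_ball_lt_top.ne
  obtain ⟨F, hF, hFf⟩ : ∃ F : E → E, LipschitzWith C F ∧ ∀ x : A, F x = f x := by
    have h1 : LipschitzOnWith 1 (Function.extend Subtype.val f 0) A := by
      rw [lipschitzOnWith_iff_restrict]
      convert hf using 1
      ext1 x
      exact Subtype.val_injective.extend_apply f 0 x
    obtain ⟨F, hF, hEq⟩ := h1.extend_finite_dimension
    refine ⟨F, by simpa using hF, fun x => ?_⟩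
    rw [← hEq x.2, Subtype.val_injective.extend_apply]
  have hmove : ∀ x ∈ Metric.closedBall c ((1 - η) * r), ‖F x - x‖ ≤ (C + 2) * η * r := by
    intro x hx
    obtain ⟨a, haA, hax⟩ : ∃ a ∈ A, dist x a ≤ η * r := by
      by_contra! hcon
      have hsub : Metric.closedBall x (η * r) ⊆ Metric.closedBall c r \ A := by
        intro y hy
        refine ⟨?_, fun hyA => ?_⟩
        · rw [Metric.mem_closedBall] at hx hy ⊢
          have := dist_triangle y x c
          linarith
        · have := hcon y hyA
          rw [Metric.mem_closedBall, dist_comm] at hy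
          linarith
      have h1 := measureReal_mono (μ := μ) hsub
        (measure_ne_top_of_subset Set.sdiff_subset measure_closedBall_lt_top.ne)
      have h2 := h1.trans hA
      rw [hball _ hηr.le, hball _ hr.le, mul_pow, mul_assoc] at h2
      have h3 : 0 < r ^ n * μ.real (Metric.ball (0 : E) 1) := by positivity
      exact absurd (le_of_mul_le_mul_right h2 h3) (not_le.2 hθη)
    have e1 : ‖F x - F a‖ ≤ C * (η * r) := by
      refine (hF.norm_sub_le x a).trans ?_
      rw [← dist_eq_norm]
      gcongr
    have e2 : ‖F a - a‖ ≤ η * r := by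
      rw [hFf ⟨a, haA⟩]
      exact hfη ⟨a, haA⟩
    have e3 : ‖a - x‖ ≤ η * r := by
      rwa [← dist_eq_norm, dist_comm]
    calc ‖F x - x‖ = ‖(F x - F a) + (F a - a) + (a - x)‖ := by congr 1; abel
      _ ≤ ‖F x - F a‖ + ‖F a - a‖ + ‖a - x‖ := norm_add₃_le
      _ ≤ C * (η * r) + η * r + η * r := by gcongr
      _ = _ := by ring
  have hcover := hF.ball_subset_image_closedBall (by positivity) hmove
  set B := Metric.closedBall c r
  have hsmall : Metric.closedBall c ((1 - D * η) * r) ⊆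
      (Set.range f ∩ B) ∪ F '' (B \ A) := by
    intro y hy
    have hy1 : y ∈ Metric.ball c ((1 - η) * r - 2 * ((C + 2) * η * r)) := by
      rw [Metric.mem_closedBall] at hy
      rw [Metric.mem_ball]
      have : (1 - η) * r - 2 * ((C + 2) * η * r) = (1 - D * η) * r + η * r := by
        simp only [D]
        ring
      linarith
    obtain ⟨x, hx, rfl⟩ := hcover hy1
    have hxB : x ∈ B := by
      refine Metric.closedBall_subset_closedBall ?_ hx
      nlinarith
    by_cases hxA : x ∈ A
    · refine Or.inl ⟨⟨⟨x, hxA⟩, (hFf ⟨x, hxA⟩).symm⟩, ?_⟩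
      refine Metric.closedBall_subset_closedBall ?_ hy
      have : 0 < D * η := by positivity
      nlinarith
    · exact Or.inr ⟨x, ⟨hxB, hxA⟩, rfl⟩
  have hBfin : μ B ≠ ⊤ := measure_closedBall_lt_top.ne
  have hBAfin : μ (B \ A) ≠ ⊤ := measure_ne_top_of_subset Set.sdiff_subset hBfin
  have himfin : (C : ENNReal) ^ n * μ (B \ A) ≠ ⊤ :=
    ENNReal.mul_ne_top (ENNReal.pow_ne_top ENNReal.coe_ne_top) hBAfin
  have him : μ.real (F '' (B \ A)) ≤ C ^ n * μ.real (B \ A) := by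
    have := ENNReal.toReal_mono himfin (hF.addHaar_image_le μ (B \ A))
    simpa [Measure.real] using this
  have hRfin : μ (Set.range f ∩ B) ≠ ⊤ := measure_ne_top_of_subset Set.inter_subset_right hBfin
  have hFfin : μ (F '' (B \ A)) ≠ ⊤ :=
    ((hF.addHaar_image_le μ (B \ A)).trans_lt himfin.lt_top).ne
  have h1 := measureReal_mono hsmall (measure_union_ne_top hRfin hFfin)
  have h2 := measureReal_union_le (μ := μ) (Set.range f ∩ B) (F '' (B \ A))
  have h3 : (1 - κ / 2) * μ.real B ≤ μ.real (Metric.closedBall c ((1 - D * η) * r)) := by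
    rw [hball _ hr.le, hball _ (mul_nonneg (by linarith) hr.le), mul_pow, mul_assoc]
    gcongr
  have h4 : (C : ℝ) ^ n * μ.real (B \ A) ≤ κ / 2 * μ.real B := by
    calc (C : ℝ) ^ n * μ.real (B \ A) ≤ C ^ n * (θ * μ.real B) := by gcongr
      _ = C ^ n * θ * μ.real B := by ring
      _ ≤ κ / 2 * μ.real B := by gcongr
  linarith

/-- The images of a bounded measurable set under `1`-Lipschitz maps close to the identity have
almost the full measure of the set. -/
theorem exists_measureReal_range_gt_of_displacement_le {E : Type*} [NormedAddCommGroup E]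
    [InnerProductSpace ℝ E] [FiniteDimensional ℝ E] [MeasurableSpace E] [BorelSpace E]
    (μ : Measure E) [μ.IsAddHaarMeasure] {A : Set E} (hAb : Bornology.IsBounded A)
    (hAm : NullMeasurableSet A μ) {ε : ℝ} (hε : 0 < ε) :
    ∃ δ > 0, ∀ f : A → E, LipschitzWith 1 f → (∀ x : A, ‖f x - x‖ ≤ δ) →
      μ.real A - ε < μ.real (Set.range f) := by
  have hAfin : μ A ≠ ⊤ := hAb.measure_lt_top.ne
  have hA0 : 0 ≤ μ.real A := measureReal_nonneg
  obtain ⟨κ, hκ, hκ1, hκε⟩ : ∃ κ > 0, κ ≤ 1 ∧ κ * μ.real A ≤ ε / 4 := by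
    refine ⟨min 1 (ε / 4 / (μ.real A + 1)), by positivity, min_le_left _ _, ?_⟩
    calc min 1 (ε / 4 / (μ.real A + 1)) * μ.real A ≤ ε / 4 / (μ.real A + 1) * (μ.real A + 1) := by
          gcongr
          · exact min_le_right _ _
          · linarith
      _ = ε / 4 := div_mul_cancel₀ _ (by positivity)
  obtain ⟨θ, hθ, η, hη, hloc⟩ := exists_measureReal_range_inter_closedBall_ge μ hκ
  set good : E → Set ℝ := fun x => {r | 0 < r ∧
    μ.real (Metric.closedBall x r \ A) ≤ θ * μ.real (Metric.closedBall x r)}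
  set s : Set E := {x | x ∈ A ∧ ∀ δ > 0, (good x ∩ Set.Ioo 0 δ).Nonempty}
  have hsA : μ (A \ s) = 0 := by
    have h1 := Besicovitch.ae_tendsto_measure_inter_div μ A
    rw [ae_restrict_iff'₀ hAm] at h1
    refine measure_mono_null ?_ (ae_iff.1 h1)
    rintro x ⟨hxA, hxs⟩ hx
    refine hxs ⟨hxA, fun δ hδ => ?_⟩
    have h2 := (hx hxA).eventually (lt_mem_nhds (show ENNReal.ofReal (1 - θ) < 1 by
      rw [ENNReal.ofReal_lt_one]
      linarith))
    obtain ⟨r, hr, hrδ⟩ := (h2.and (Ioo_mem_nhdsGT hδ)).exists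
    refine ⟨r, ⟨hrδ.1, ?_⟩, hrδ⟩
    have hBfin : μ (Metric.closedBall x r) ≠ ⊤ := measure_closedBall_lt_top.ne
    have hBpos : μ (Metric.closedBall x r) ≠ 0 := (Metric.measure_closedBall_pos μ x hrδ.1).ne'
    rw [ENNReal.lt_div_iff_mul_lt (Or.inl hBpos) (Or.inl hBfin)] at hr
    have h3 := ENNReal.toReal_mono
      (measure_ne_top_of_subset Set.inter_subset_right hBfin) hr.le
    rw [ENNReal.toReal_mul] at h3
    have h4 : (1 - θ) * μ.real (Metric.closedBall x r) ≤ μ.real (A ∩ Metric.closedBall x r) :=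
      le_trans (mul_le_mul_of_nonneg_right
        ((le_max_left _ _).trans_eq ENNReal.toReal_ofReal'.symm) measureReal_nonneg) h3
    have h5 := measureReal_inter_add_sdiff₀ (μ := μ) (s := Metric.closedBall x r) hAm hBfin
    rw [Set.inter_comm] at h5
    linarith
  obtain ⟨t, r, htc, -, htr, htcov, htd⟩ :=
    Besicovitch.exists_disjoint_closedBall_covering_ae μ good s (fun x hx => hx.2) (fun _ => 1)
      (fun _ _ => one_pos)
  have hUfull : μ (A \ ⋃ x ∈ t, Metric.closedBall x (r x)) = 0 := by
    refine measure_mono_null (t := (A \ s) ∪ (s \ ⋃ x ∈ t, Metric.closedBall x (r x))) ?_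
      (measure_union_null hsA htcov)
    rintro x ⟨hxA, hxU⟩
    by_cases hxs : x ∈ s
    · exact Or.inr ⟨hxs, hxU⟩
    · exact Or.inl ⟨hxA, hxs⟩
  -- Restricting the measure to `A` leaves only the balls to be measurable.
  have hsum : ∑' x : t, μ (Metric.closedBall (x : E) (r x) ∩ A) = μ A := by
    have h1 := measure_biUnion (μ := μ.restrict A) htc htd fun _ _ =>
      Metric.isClosed_closedBall.measurableSet
    have hU : MeasurableSet (⋃ x ∈ t, Metric.closedBall x (r x)) :=
      MeasurableSet.biUnion htc fun _ _ => Metric.isClosed_closedBall.measurableSet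
    rw [Measure.restrict_apply hU] at h1
    have h2 := measure_inter_add_sdiff (μ := μ) A hU
    rw [hUfull, add_zero, Set.inter_comm, h1] at h2
    rw [← h2]
    exact tsum_congr fun x => (Measure.restrict_apply Metric.isClosed_closedBall.measurableSet).symm
  obtain ⟨T, hT⟩ : ∃ T : Finset t,
      μ.real A - ε / 2 < ∑ x ∈ T, μ.real (Metric.closedBall (x : E) (r x)) := by
    have h1 : HasSum (fun x : t => μ.real (Metric.closedBall (x : E) (r x) ∩ A)) (μ.real A) := by
      have h2 := ENNReal.hasSum_toReal (hsum.trans_ne hAfin)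
      rwa [← ENNReal.tsum_toReal_eq fun x =>
        measure_ne_top_of_subset Set.inter_subset_right hAfin, hsum] at h2
    obtain ⟨T, hT⟩ := (h1.eventually
      (lt_mem_nhds (show μ.real A - ε / 2 < μ.real A by linarith))).exists
    exact ⟨T, hT.trans_le (Finset.sum_le_sum fun x _ =>
      measureReal_mono Set.inter_subset_left measure_closedBall_lt_top.ne)⟩
  -- Positivity is demanded separately because `T` may be empty.
  obtain ⟨δ, hδT, hδ⟩ : ∃ δ, (∀ x ∈ T, δ ∈ Set.Ioo 0 (η * r x)) ∧ δ ∈ Set.Ioi (0 : ℝ) := by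
    refine (((Filter.eventually_all_finset T).2 fun x _ => ?_).and self_mem_nhdsWithin).exists
      (f := nhdsWithin (0 : ℝ) (Set.Ioi 0))
    exact Ioo_mem_nhdsGT (mul_pos hη (htr x x.2).2.1)
  refine ⟨δ, hδ, fun f hf hfδ => ?_⟩
  have hRb : Bornology.IsBounded (Set.range f) := by
    obtain ⟨M, hM⟩ := hAb.exists_norm_le
    refine isBounded_iff_forall_norm_le.2 ⟨δ + M, ?_⟩
    rintro _ ⟨x, rfl⟩
    have h1 := norm_le_norm_add_norm_sub' (f x) (x : E)
    have h2 := hfδ x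
    have h3 := hM x x.2
    linarith
  have hRfin : μ (Set.range f) ≠ ⊤ := hRb.measure_lt_top.ne
  -- Additivity is applied to the measure restricted to the image, so no measurability of the image
  -- is needed.
  have hbig : ∑ x ∈ T, (1 - κ) * μ.real (Metric.closedBall (x : E) (r x)) ≤
      μ.real (Set.range f) := by
    calc ∑ x ∈ T, (1 - κ) * μ.real (Metric.closedBall (x : E) (r x))
        ≤ ∑ x ∈ T, (μ.restrict (Set.range f)).real (Metric.closedBall (x : E) (r x)) := by
          refine Finset.sum_le_sum fun x hx => ?_
          rw [measureReal_restrict_apply Metric.isClosed_closedBall.measurableSet, Set.inter_comm]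
          obtain ⟨hg, h0, -⟩ := htr x x.2
          exact hloc A x (r x) h0 hg.2 f hf fun y => (hfδ y).trans (hδT x hx).2.le
      _ = (μ.restrict (Set.range f)).real (⋃ x ∈ T, Metric.closedBall (x : E) (r x)) := by
          refine (measureReal_biUnion_finset ?_ ?_ ?_).symm
          · intro x _ y _ hxy
            exact htd x.2 y.2 (Subtype.coe_injective.ne hxy)
          · exact fun _ _ => Metric.isClosed_closedBall.measurableSet
          · exact fun _ _ =>
              ((Measure.restrict_apply_le _ _).trans_lt measure_closedBall_lt_top).ne
      _ ≤ μ.real (Set.range f) := by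
          rw [measureReal_restrict_apply
            (T.measurableSet_biUnion fun _ _ => Metric.isClosed_closedBall.measurableSet)]
          exact measureReal_mono Set.inter_subset_right hRfin
  rw [← Finset.mul_sum] at hbig
  have h1 : (1 - κ) * (μ.real A - ε / 2) ≤
      (1 - κ) * ∑ x ∈ T, μ.real (Metric.closedBall (x : E) (r x)) := by
    gcongr
  have h2 : 0 < κ * ε := by positivity
  nlinarith

theorem mainTheorem2 (d : ℕ) (A : Set (EuclideanSpace ℝ (Fin d)))
    (hA : NullMeasurableSet A volume) (h : IsDistanceKolmogorov A) :
    IsMeasureKolmogorov A := by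
  refine ⟨h.1, hA, fun ε hε => ?_⟩
  obtain ⟨δ, hδ, hmeas⟩ := exists_measureReal_range_gt_of_displacement_le volume h.1 hA hε
  obtain ⟨f, hf, hpoly, hdisp⟩ := h.2 δ hδ
  exact ⟨f, hf, hpoly, hmeas f hf hdisp⟩
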